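/- Let $f:\mathbb R^n\times\mathbb R\to\mathbb R^n$, $F:\mathbb R^m\times\mathbb R\to\mathbb R^m$ and $h:\mathbb R^m\to\mathbb R^n$ be continuous, with $f(\cdot,t)$ of class $C^2$ for every $t$. Norms are Euclidean norms and the operator norms they induce; "solution" means solution on all of $\mathbb R$. Assume: (C1) $f(u,t+1)=f(u,t)$ for all $u,t$. (C2) The system $z'=f(z,t)$ has a hyperbolic periodic solution $p$ (its variational equation $v'=D_uf(p(t),t)v$ has an exponential dichotomy on $\mathbb R$) and a solution $q\neq p$ homoclinic to $p$ (that is, $q(t)-p(t)\to 0$ as $t\to\pm\infty$) such that the only solution of $v'=D_uf(q(t),t)v$ that is bounded on $\mathbb R$ is $v=0$. (C3) $\|F(x,t)\|\le H_0$ for all $x,t$, for some $H_0>0$. (C4) There are $L_1,L_2,L_3>0$ with $L_1\|x_1-x_2\|\le\|h(x_1)-h(x_2)\|\le L_2\|x_1-x_2\|$ for all $x_1,x_2$ and $\|f(u_1,t)-f(u_2,t)\|\le L_3\|u_1-u_2\|$ for all $u_1,u_2,t$. (C5) $\|f(u,t)\|\le M_f$ for all $u,t$, for some $M_f>0$. Let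 $(\nu_\beta)$, indexed by the doubly infinite sequences $\beta$ in a finite alphabet, be a family of bounded solutions of $z'=f(z,t)$ for which the linear systems $v'=D_uf(\nu_\beta(t),t)v$ have exponential dichotomies on $\mathbb R$ with constants $K,\alpha>0$ independent of $\beta$: there are a fundamental solution $V_\beta$ and a projection $P_\beta$ with $\|V_\beta(t)P_\beta V_\beta(s)^{-1}\|\le Ke^{-\alpha(t-s)}$ for $t\ge s$ and $\|V_\beta(t)(I-P_\beta)V_\beta(s)^{-1}\|\le Ke^{\alpha(t-s)}$ for $t\le s$. Let $H>0$, $M_h=\sup_{\|x\|\le H}\|h(x)\|$, let $P_2>0$ and put $$r_1=\frac{\frac{4KP_2}{\alpha}M_h}{1+\sqrt{1-\frac{16K^2P_2^2}{\alpha^2}M_h}} .$$ Assume that $\|D_{uu}f(u,t)\|\le P_2$ whenever $\|u-\nu_\beta(t)\|\le r_1$ for some $\beta$, and that (C6) $M_h<\dfrac{\alpha^2}{16K^2P_2^2}$. Let $x$ be a solution of $x'=F(x,t)$ with $\sup_t\|x(t)\|\le H$, fix $\beta$, and let $\phi=\phi_x^\beta$ be a solution of $$y'=D_uf(\nu_\beta,t)y+f(y+\nu_\beta,t)-f(\nu_\beta,t)-D_uf(\nu_\beta,t)y+h(x(t))$$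 with $\sup_t\|\phi(t)\|\le r_1$. A continuous function $g$ on $\mathbb R$ is called almost periodic if for every $\epsilon>0$ there is $l>0$ such that every interval of length $l$ contains a number $\omega$ with $\|g(t+\omega)-g(t)\|<\epsilon$ for all $t\in\mathbb R$. If $x$ and $\nu_\beta$ are almost periodic, then $\phi_x^\beta$ is almost periodic. Moreover, for all natural numbers $i$ and $\bar l$, if $x$ and $\nu_\beta$ are both $i\bar l$-periodic, then $\phi_x^\beta$ is $i\bar l$-periodic. -/

import Mathlib

/-- The Euclidean space `ℝⁿ`. -/
abbrev Euc (n : ℕ) : Type := EuclideanSpace ℝ (Fin n)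

/-- `z` is a solution on all of `ℝ` of the system `z' = g(z, t)`. -/
def IsSolution {n : ℕ} (g : Euc n → ℝ → Euc n) (z : ℝ → Euc n) : Prop :=
  ∀ t : ℝ, HasDerivAt z (g (z t) t) t

/-- The derivative `D_u f(u, t)`. -/
noncomputable def Du {n : ℕ} (f : Euc n → ℝ → Euc n) (u : Euc n) (t : ℝ) :
    Euc n →L[ℝ] Euc n :=
  fderiv ℝ (fun v => f v t) u

/-- The second derivative `D_{uu} f(u, t)`, with values in (curried) bilinear maps. -/
noncomputable def Duu {n : ℕ} (f : Euc n → ℝ → Euc n) (u : Euc n) (t : ℝ) :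
    Euc n →L[ℝ] Euc n →L[ℝ] Euc n :=
  fderiv ℝ (fun v => Du f v t) u

/-- `z` is bounded on `ℝ`. -/
def IsBoundedOnLine {n : ℕ} (z : ℝ → Euc n) : Prop :=
  ∃ B : ℝ, ∀ t : ℝ, ‖z t‖ ≤ B

/-- The linear system `v' = A(t) v` has an exponential dichotomy on `ℝ` with constants `K` and
`α`: for a fundamental solution `V` (each `V(t)` is invertible and each `V(·) v` is a solution) and
a projection `P`,
`‖V(t) P V(s)⁻¹‖ ≤ K e^{-α(t-s)}` for `t ≥ s` and
`‖V(t) (I - P) V(s)⁻¹‖ ≤ K e^{α(t-s)}` for `t ≤ s`. -/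
def HasExpDichotomy {n : ℕ} (A : ℝ → Euc n →L[ℝ] Euc n) (K α : ℝ) : Prop :=
  ∃ (V : ℝ → (Euc n ≃L[ℝ] Euc n)) (P : Euc n →L[ℝ] Euc n),
    (∀ v : Euc n, IsSolution (fun w t => A t w) (fun t => V t v)) ∧
    P.comp P = P ∧
    (∀ t s : ℝ, s ≤ t →
      ‖(V t : Euc n →L[ℝ] Euc n).comp (P.comp ((V s).symm : Euc n →L[ℝ] Euc n))‖
        ≤ K * Real.exp (-α * (t - s))) ∧
    (∀ t s : ℝ, t ≤ s →
      ‖(V t : Euc n →L[ℝ] Euc n).comp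
          ((ContinuousLinearMap.id ℝ (Euc n) - P).comp ((V s).symm : Euc n →L[ℝ] Euc n))‖
        ≤ K * Real.exp (α * (t - s)))

/-- `p` is a hyperbolic periodic solution of `z' = f(z, t)`: a periodic solution whose
variational equation has an exponential dichotomy on `ℝ` (if the variational equation is periodic,
this says that no Floquet multiplier lies on the unit circle). -/
def IsHyperbolicPeriodicSolution {n : ℕ} (f : Euc n → ℝ → Euc n) (p : ℝ → Euc n) : Prop :=
  IsSolution f p ∧ (∃ T : ℝ, 0 < T ∧ Function.Periodic p T) ∧
    ∃ K α : ℝ, 0 < K ∧ 0 < α ∧ HasExpDichotomy (fun t => Du f (p t) t) K α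

/-- `q` is a solution of `z' = f(z, t)` homoclinic to `p`. -/
def IsHomoclinicSolution {n : ℕ} (f : Euc n → ℝ → Euc n) (p q : ℝ → Euc n) : Prop :=
  IsSolution f q ∧ q ≠ p ∧
    Filter.Tendsto (fun t => q t - p t) Filter.atTop (nhds 0) ∧
    Filter.Tendsto (fun t => q t - p t) Filter.atBot (nhds 0)

/-- The only solution of the variational equation `v' = D_u f(q(t), t) v` that is bounded on `ℝ`
is the zero solution. -/
def VariationalOnlyZeroBounded {n : ℕ} (f : Euc n → ℝ → Euc n) (q : ℝ → Euc n) : Prop :=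
  ∀ v : ℝ → Euc n, IsSolution (fun w t => Du f (q t) t w) v → IsBoundedOnLine v →
    ∀ t : ℝ, v t = 0

/-- The solutions `x` of `x' = F(x, t)` with `‖x(t)‖ ≤ H` for all `t`. -/
def boundedSolutions {m : ℕ} (F : Euc m → ℝ → Euc m) (H : ℝ) : Set (ℝ → Euc m) :=
  {x | IsSolution F x ∧ ∀ t : ℝ, ‖x t‖ ≤ H}

/-- `M_h = sup_{‖x‖ ≤ H} ‖h(x)‖`. -/
noncomputable def supOnBall {m n : ℕ} (h : Euc m → Euc n) (H : ℝ) : ℝ :=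
  sSup ((fun x => ‖h x‖) '' Metric.closedBall (0 : Euc m) H)

/-- The radius
`r₁ = ((4 K P₂ / α) M) / (1 + √(1 - (16 K² P₂² / α²) M))`. -/
noncomputable def r1 (K α P₂ M : ℝ) : ℝ :=
  (4 * K * P₂ / α * M) / (1 + Real.sqrt (1 - 16 * K ^ 2 * P₂ ^ 2 / α ^ 2 * M))

/-- The right-hand side of the system
`y' = D_u f(ν,t) y + f(y+ν,t) - f(ν,t) - D_u f(ν,t) y + h(x)`
obtained from `u' = f(u,t) + h(x(t))` by the substitution `u = y + ν(t)`. -/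
noncomputable def shiftedField {m n : ℕ} (f : Euc n → ℝ → Euc n) (h : Euc m → Euc n)
    (ν : ℝ → Euc n) (x : ℝ → Euc m) (y : Euc n) (t : ℝ) : Euc n :=
  Du f (ν t) t y + f (y + ν t) t - f (ν t) t - Du f (ν t) t y + h (x t)

/-- Almost periodic functions (in the sense of Bohr). -/
def IsAlmostPeriodic {n : ℕ} (g : ℝ → Euc n) : Prop :=
  Continuous g ∧ ∀ ε : ℝ, 0 < ε → ∃ l : ℝ, 0 < l ∧ ∀ a : ℝ, ∃ ω ∈ Set.Icc a (a + l),
    ∀ t : ℝ, ‖g (t + ω) - g t‖ < ε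

/-!
Writing `u = φ + ν_β`, a solution `φ` of the shifted system is a bounded perturbation of `ν_β`, and
the question is how much `φ` changes under an integer translation `ω`. As `f` is `1`-periodic, the
translate of `φ` solves the same kind of system, with `x` and `ν_β` replaced by their translates.
Hence `d(t) = φ(t + ω) - φ(t)` is a bounded solution of `d' = D_u f(ν_β, t) d + g`, where
* the second-derivative bound on the tube of radius `r₁` gives `‖g‖ ≤ P₂ r₁ ‖d‖` up to an error,
* the error is at most `(L₂ + 2 L₃) ε` when `ω` is an `ε`-almost period of `x` and of `ν_β`, because
  `f` and `h` are Lipschitz (`norm_tube_diff_le`).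

An exponential dichotomy bounds a bounded solution of `d' = A d + g` by `(2 K / α) sup ‖g‖`
(`HasExpDichotomy.norm_le`), and `r₁ ≤ α / (4 K P₂)` (`r1_mul_le`) makes the term `P₂ r₁ ‖d‖`
absorbable, so that `‖φ(t + ω) - φ(t)‖ ≤ (4 K / α) (L₂ + 2 L₃) ε` (`norm_shift_sub_le`).

For a common period `ω` of `x` and `ν_β` one takes `ε = 0`. For almost periodicity one needs common
*integer* `ε`-almost periods of `x` and `ν_β` in every interval of a fixed length. These come from a
pigeonhole argument: the integer translates of an almost periodic, uniformly continuous function fall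
into finitely many classes of uniformly close functions (`IsAlmostPeriodic.exists_coloring`), and two
integers in the same class for both functions differ by a common almost period.
-/

/-! ### Bounded solutions of linear systems with an exponential dichotomy -/

/-- A function that is dominated by a decaying exponential in the past, with derivative dominated
by the same exponential, satisfies the bound obtained by integrating the derivative from `-∞`. -/
lemma norm_le_of_exp_bounds {E : Type*} [NormedAddCommGroup E] [NormedSpace ℝ E]
    {Φ Φ' : ℝ → E} {t C D α : ℝ} (hα : 0 < α)
    (hΦ : ∀ r, HasDerivAt Φ (Φ' r) r)
    (hb : ∀ r ≤ t, ‖Φ r‖ ≤ C * Real.exp (-α * (t - r)))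
    (hb' : ∀ r ≤ t, ‖Φ' r‖ ≤ D * Real.exp (-α * (t - r))) :
    ‖Φ t‖ ≤ D / α := by
  have hexp : ∀ r : ℝ, HasDerivAt (fun r => Real.exp (-α * (t - r)))
      (α * Real.exp (-α * (t - r))) r := by
    intro r
    have h1 : HasDerivAt (fun r => -α * (t - r)) α r := by
      simpa using ((hasDerivAt_id r).const_sub t).const_mul (-α)
    simpa [mul_comm] using h1.exp
  have key : ∀ s ≤ t, ‖Φ t‖ ≤ C * Real.exp (-α * (t - s)) +
      D / α * (1 - Real.exp (-α * (t - s))) := by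
    intro s hs
    have hB : ∀ r : ℝ, HasDerivAt (fun r => C * Real.exp (-α * (t - s)) +
        D / α * (Real.exp (-α * (t - r)) - Real.exp (-α * (t - s))))
        (D * Real.exp (-α * (t - r))) r := by
      intro r
      have h1 := (((hexp r).sub_const (Real.exp (-α * (t - s)))).const_mul (D / α)).const_add
        (C * Real.exp (-α * (t - s)))
      exact h1.congr_deriv (by field_simp)
    have := image_norm_le_of_norm_deriv_right_le_deriv_boundary' (f := Φ) (f' := Φ') (a := s)
      (b := t) (fun r _ => (hΦ r).continuousAt.continuousWithinAt)
      (fun r _ => (hΦ r).hasDerivWithinAt)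
      (B := fun r => C * Real.exp (-α * (t - s)) +
        D / α * (Real.exp (-α * (t - r)) - Real.exp (-α * (t - s))))
      (B' := fun r => D * Real.exp (-α * (t - r)))
      (by simpa using hb s hs)
      (fun r _ => (hB r).continuousAt.continuousWithinAt)
      (fun r _ => (hB r).hasDerivWithinAt)
      (fun r hr => hb' r hr.2.le) (Set.right_mem_Icc.2 hs)
    simpa using this
  have hlim : Filter.Tendsto (fun s => Real.exp (-α * (t - s))) Filter.atBot (nhds 0) := by
    refine Real.tendsto_exp_atBot.comp ?_
    have h1 : Filter.Tendsto (fun s : ℝ => α * s + -(α * t)) Filter.atBot Filter.atBot :=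
      Filter.tendsto_atBot_add_const_right _ _ (Filter.tendsto_id.const_mul_atBot hα)
    refine h1.congr fun s => ?_
    ring
  have hlim' : Filter.Tendsto (fun s => C * Real.exp (-α * (t - s)) +
      D / α * (1 - Real.exp (-α * (t - s)))) Filter.atBot (nhds (D / α)) := by
    simpa using (hlim.const_mul C).add ((hlim.const_sub 1).const_mul (D / α))
  refine ge_of_tendsto hlim' ?_
  filter_upwards [Filter.eventually_le_atBot t] with s hs using key s hs

/-- On a Euclidean space, a pointwise differentiable family of operators is differentiable in the
operator norm. -/
lemma hasDerivAt_clm_of_apply {n : ℕ} {W : ℝ → Euc n →L[ℝ] Euc n} {W' : Euc n →L[ℝ] Euc n}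
    {t : ℝ} (hW : ∀ v, HasDerivAt (fun r => W r v) (W' v) t) : HasDerivAt W W' t := by
  let b := EuclideanSpace.basisFun (Fin n) ℝ
  have expand : ∀ T : Euc n →L[ℝ] Euc n,
      T = ∑ i, (innerSL ℝ (b i)).smulRight (T (b i)) := by
    intro T
    ext1 v
    conv_lhs => rw [← b.sum_repr' v]
    simp [map_sum]
  have h1 : HasDerivAt (fun r => ∑ i, (innerSL ℝ (b i)).smulRight (W r (b i)))
      (∑ i, (innerSL ℝ (b i)).smulRight (W' (b i))) t := by
    refine HasDerivAt.fun_sum fun i _ => ?_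
    exact ((ContinuousLinearMap.smulRightL ℝ (Euc n) (Euc n)
      (innerSL ℝ (b i))).hasFDerivAt).comp_hasDerivAt t (hW (b i))
  rw [← expand W'] at h1
  exact h1.congr_of_eventuallyEq (Filter.Eventually.of_forall fun r => expand (W r))

/-- Variation of constants in differential form: if `V` is a fundamental solution of `v' = A v`
and `d' = A d + g`, then `(V⁻¹ d)' = V⁻¹ g`. -/
lemma hasDerivAt_symm_apply {n : ℕ} {A : ℝ → Euc n →L[ℝ] Euc n} {V : ℝ → (Euc n ≃L[ℝ] Euc n)}
    (hV : ∀ v : Euc n, IsSolution (fun w t => A t w) (fun t => V t v))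
    {d g : ℝ → Euc n} (hd : ∀ t, HasDerivAt d (A t (d t) + g t) t) (t : ℝ) :
    HasDerivAt (fun r => (V r).symm (d r)) ((V t).symm (g t)) t := by
  have h1 : HasDerivAt (fun r => (V r : Euc n →L[ℝ] Euc n))
      ((A t).comp (V t : Euc n →L[ℝ] Euc n)) t :=
    hasDerivAt_clm_of_apply fun v => hV v t
  have hinv : ∀ r, Ring.inverse (V r : Euc n →L[ℝ] Euc n)
      = ((V r).symm : Euc n →L[ℝ] Euc n) := fun r => by
    rw [ContinuousLinearMap.ringInverse_equiv, ContinuousLinearMap.inverse_equiv]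
  let U : (Euc n →L[ℝ] Euc n)ˣ :=
    ⟨(V t : Euc n →L[ℝ] Euc n), ((V t).symm : Euc n →L[ℝ] Euc n),
      by ext1 v; simp, by ext1 v; simp⟩
  have h2 := (hasFDerivAt_ringInverse (𝕜 := ℝ) U).comp_hasDerivAt t h1
  have h3 : HasDerivAt (fun r => ((V r).symm : Euc n →L[ℝ] Euc n))
      (-(((V t).symm : Euc n →L[ℝ] Euc n).comp (A t))) t := by
    refine (h2.congr_of_eventuallyEq
      (Filter.Eventually.of_forall fun r => (hinv r).symm)).congr_deriv ?_
    ext1 v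
    simp [U, ContinuousLinearMap.mul_def]
  refine (h3.clm_apply (hd t)).congr_deriv ?_
  simp

/-- A bounded solution of `d' = A d + g` is bounded by `(2 K / α) sup ‖g‖`: on the stable part one
integrates from `-∞`, on the unstable part from `+∞`. -/
lemma HasExpDichotomy.norm_le {n : ℕ} {A : ℝ → Euc n →L[ℝ] Euc n} {K α : ℝ} (hK : 0 < K)
    (hα : 0 < α) (hA : HasExpDichotomy A K α) {d g : ℝ → Euc n} {B G : ℝ}
    (hd : ∀ t, HasDerivAt d (A t (d t) + g t) t) (hdB : ∀ t, ‖d t‖ ≤ B)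
    (hg : ∀ t, ‖g t‖ ≤ G) (t : ℝ) : ‖d t‖ ≤ 2 * K / α * G := by
  obtain ⟨V, P, hV, -, hst, hun⟩ := hA
  let W : Euc n →L[ℝ] Euc n := V t
  let V' : ℝ → Euc n →L[ℝ] Euc n := fun r => (V r).symm
  let Q : Euc n →L[ℝ] Euc n := ContinuousLinearMap.id ℝ (Euc n) - P
  have hderiv : ∀ r, HasDerivAt (fun r => V' r (d r)) (V' r (g r)) r :=
    hasDerivAt_symm_apply hV hd
  have hst' : ∀ r ≤ t, ‖W.comp (P.comp (V' r))‖ ≤ K * Real.exp (-α * (t - r)) :=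
    fun r hr => hst t r hr
  have hun' : ∀ r, t ≤ r → ‖W.comp (Q.comp (V' r))‖ ≤ K * Real.exp (α * (t - r)) :=
    fun r hr => hun t r hr
  have hbound : ∀ (R S : Euc n →L[ℝ] Euc n) (v : Euc n) (a e : ℝ), 0 ≤ e →
      ‖W.comp (R.comp S)‖ ≤ K * e → ‖v‖ ≤ a → ‖W (R (S v))‖ ≤ K * a * e :=
    fun R S v a e he hT hv => ((W.comp (R.comp S)).le_opNorm v).trans
      ((mul_le_mul hT hv (norm_nonneg _) (by positivity)).trans_eq (by ring))
  have h1 : ‖W (P (V' t (d t)))‖ ≤ K * G / α := by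
    refine norm_le_of_exp_bounds (Φ := fun r => W (P (V' r (d r))))
      (Φ' := fun r => W (P (V' r (g r)))) (C := K * B) hα (fun r => ?_)
      (fun r hr => ?_) (fun r hr => ?_)
    · exact ((W.comp P).hasFDerivAt).comp_hasDerivAt r (hderiv r)
    · exact hbound P (V' r) (d r) _ _ (Real.exp_pos _).le (hst' r hr) (hdB r)
    · exact hbound P (V' r) (g r) _ _ (Real.exp_pos _).le (hst' r hr) (hg r)
  have h2 : ‖W (Q (V' t (d t)))‖ ≤ K * G / α := by
    -- Reversing time turns decay in the future into decay in the past.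
    have hun'' : ∀ r ≤ -t, ‖W.comp (Q.comp (V' (-r)))‖ ≤ K * Real.exp (-α * (-t - r)) :=
      fun r hr => (hun' (-r) (by linarith)).trans_eq (by ring_nf)
    have h3 := norm_le_of_exp_bounds (Φ := fun r => W (Q (V' (-r) (d (-r)))))
      (Φ' := fun r => -W (Q (V' (-r) (g (-r))))) (t := -t) (C := K * B) (D := K * G) hα
      (fun r => ?_) (fun r hr => ?_) (fun r hr => ?_)
    · simpa only [neg_neg] using h3
    · have h4 : HasDerivAt (fun r => W (Q (V' r (d r)))) (W (Q (V' (-r) (g (-r))))) (-r) :=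
        ((W.comp Q).hasFDerivAt).comp_hasDerivAt (-r) (hderiv (-r))
      exact (h4.scomp r (hasDerivAt_neg r)).congr_deriv (by rw [neg_smul, one_smul])
    · exact hbound Q (V' (-r)) (d (-r)) _ _ (Real.exp_pos _).le (hun'' r hr) (hdB (-r))
    · rw [norm_neg]
      exact hbound Q (V' (-r)) (g (-r)) _ _ (Real.exp_pos _).le (hun'' r hr) (hg (-r))
  have h5 : d t = W (P (V' t (d t))) + W (Q (V' t (d t))) := by
    simp [W, V', Q]
  rw [h5]
  refine (norm_add_le _ _).trans ((add_le_add h1 h2).trans_eq ?_)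
  ring

/-- If the perturbation of a linear system with a dichotomy is `c ‖d‖ + G` with
`(2 K / α) c ≤ 1 / 2`, then the term `c ‖d‖` only doubles the bound on bounded solutions. -/
lemma HasExpDichotomy.norm_le_of_perturbation {n : ℕ} {A : ℝ → Euc n →L[ℝ] Euc n} {K α : ℝ}
    (hK : 0 < K) (hα : 0 < α) (hA : HasExpDichotomy A K α) {d d' : ℝ → Euc n} {B G c : ℝ}
    (hc0 : 0 ≤ c) (hc : 2 * K / α * c ≤ 1 / 2) (hd : ∀ t, HasDerivAt d (d' t) t)
    (hdB : ∀ t, ‖d t‖ ≤ B) (hd' : ∀ t, ‖d' t - A t (d t)‖ ≤ c * ‖d t‖ + G) (t : ℝ) :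
    ‖d t‖ ≤ 4 * K / α * G := by
  have hbdd : BddAbove (Set.range fun t => ‖d t‖) := ⟨B, by rintro _ ⟨t, rfl⟩; exact hdB t⟩
  set S : ℝ := ⨆ t, ‖d t‖
  have hS : ∀ t, ‖d t‖ ≤ S := le_ciSup hbdd
  have h1 : ∀ t, ‖d t‖ ≤ 2 * K / α * (c * S + G) :=
    hA.norm_le hK hα (g := fun t => d' t - A t (d t)) (fun t => by simpa using hd t) hdB
      fun t => (hd' t).trans (by gcongr; exact hS t)
  have h2 : S ≤ 2 * K / α * (c * S + G) := ciSup_le h1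
  have h3 : 2 * K / α * c * S ≤ 1 / 2 * S :=
    mul_le_mul_of_nonneg_right hc ((norm_nonneg _).trans (hS t))
  have h4 : 4 * K / α * G = 2 * (2 * K / α * G) := by ring
  rw [h4]
  linarith [hS t]

/-! ### The nonlinear estimate on the tube of radius `r₁` -/

/-- `r₁` is the smaller root of a quadratic equation, and lies below its vertex `α / (4 K P₂)`. -/
lemma r1_mul_le {K α P₂ M : ℝ} (hK : 0 < K) (hα : 0 < α) (hP₂ : 0 < P₂)
    (hM : M < α ^ 2 / (16 * K ^ 2 * P₂ ^ 2)) :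
    2 * K / α * (P₂ * r1 K α P₂ M) ≤ 1 / 2 := by
  have hM' : 0 ≤ 1 - 16 * K ^ 2 * P₂ ^ 2 / α ^ 2 * M := by
    rw [lt_div_iff₀ (by positivity)] at hM
    rw [div_mul_eq_mul_div, sub_nonneg, div_le_one (by positivity)]
    linarith
  set s := Real.sqrt (1 - 16 * K ^ 2 * P₂ ^ 2 / α ^ 2 * M) with hs
  have hs0 : 0 ≤ s := Real.sqrt_nonneg _
  have hsq : s ^ 2 = 1 - 16 * K ^ 2 * P₂ ^ 2 / α ^ 2 * M := Real.sq_sqrt hM'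
  have h1 : 2 * K / α * (P₂ * r1 K α P₂ M) = (1 - s) / 2 := by
    have h2 : 2 * K / α * (P₂ * r1 K α P₂ M)
        = (16 * K ^ 2 * P₂ ^ 2 / α ^ 2 * M) / (2 * (1 + s)) := by
      unfold r1
      rw [← hs]
      field_simp
      ring
    rw [h2, div_eq_div_iff (by positivity) two_ne_zero]
    linear_combination 2 * hsq
  rw [h1]
  linarith

/-- Near a point where the second derivative of `f` is bounded by `P₂`, the map `f` differs from its
linearization at the centre by a map with Lipschitz constant `P₂ r`. -/
lemma norm_sub_sub_Du_le {n : ℕ} {f : Euc n → ℝ → Euc n} {t : ℝ}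
    (hf2 : ContDiff ℝ 2 (fun u => f u t)) {a : Euc n} {r P₂ : ℝ} (hP₂ : 0 ≤ P₂)
    (hD : ∀ u, ‖u - a‖ ≤ r → ‖Duu f u t‖ ≤ P₂) {u₁ u₂ : Euc n} (h₁ : ‖u₁ - a‖ ≤ r)
    (h₂ : ‖u₂ - a‖ ≤ r) :
    ‖f u₁ t - f u₂ t - Du f a t (u₁ - u₂)‖ ≤ P₂ * r * ‖u₁ - u₂‖ := by
  have hDu : Differentiable ℝ (fun u => Du f u t) :=
    (hf2.fderiv_right (m := 1) (by norm_num)).differentiable (by norm_num)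
  have hmem : ∀ {u}, u ∈ Metric.closedBall a r ↔ ‖u - a‖ ≤ r := by simp [dist_eq_norm]
  have hr : 0 ≤ r := (norm_nonneg _).trans h₁
  refine (convex_closedBall a r).norm_image_sub_le_of_norm_fderiv_le' (f := fun u => f u t)
    (fun u _ => hf2.differentiable (by norm_num) u) (fun u hu => ?_) (hmem.2 h₂) (hmem.2 h₁)
  refine ((convex_closedBall a r).norm_image_sub_le_of_norm_fderiv_le (fun v _ => hDu v)
    (fun v hv => hD v (hmem.1 hv)) (Metric.mem_closedBall_self hr) hu).trans ?_
  exact mul_le_mul_of_nonneg_left (hmem.1 hu) hP₂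

/-- The difference of the shifted fields along two centres `a`, `b` (at distance at most `ε`) and
two forcing values at distance at most `G`, compared with the linearization at `a`. Only the tube
around `a` is used: replacing `b` by `a` costs the Lipschitz constant of `f` twice. -/
lemma norm_tube_diff_le {n : ℕ} {f : Euc n → ℝ → Euc n} {t : ℝ}
    (hf2 : ContDiff ℝ 2 (fun u => f u t)) {L : ℝ} (hL : 0 ≤ L)
    (hfL : ∀ u₁ u₂ : Euc n, ‖f u₁ t - f u₂ t‖ ≤ L * ‖u₁ - u₂‖)
    {a b : Euc n} {r P₂ ε G : ℝ} (hP₂ : 0 ≤ P₂)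
    (hD : ∀ u, ‖u - a‖ ≤ r → ‖Duu f u t‖ ≤ P₂) (hab : ‖b - a‖ ≤ ε)
    {y₁ y₂ k₁ k₂ : Euc n} (h₁ : ‖y₁‖ ≤ r) (h₂ : ‖y₂‖ ≤ r) (hk : ‖k₁ - k₂‖ ≤ G) :
    ‖(f (y₁ + b) t - f b t + k₁) - (f (y₂ + a) t - f a t + k₂) - Du f a t (y₁ - y₂)‖
      ≤ P₂ * r * ‖y₁ - y₂‖ + (2 * L * ε + G) := by
  have e1 : ‖f (y₁ + a) t - f (y₂ + a) t - Du f a t (y₁ - y₂)‖ ≤ P₂ * r * ‖y₁ - y₂‖ := by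
    simpa using norm_sub_sub_Du_le hf2 hP₂ hD (u₁ := y₁ + a) (u₂ := y₂ + a) (by simpa using h₁)
      (by simpa using h₂)
  have e2 : ‖f (y₁ + b) t - f (y₁ + a) t‖ ≤ L * ε :=
    (hfL _ _).trans (by simpa using mul_le_mul_of_nonneg_left hab hL)
  have e3 : ‖f b t - f a t‖ ≤ L * ε := (hfL _ _).trans (mul_le_mul_of_nonneg_left hab hL)
  calc ‖(f (y₁ + b) t - f b t + k₁) - (f (y₂ + a) t - f a t + k₂) - Du f a t (y₁ - y₂)‖
      = ‖(f (y₁ + a) t - f (y₂ + a) t - Du f a t (y₁ - y₂)) + (f (y₁ + b) t - f (y₁ + a) t)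
          - (f b t - f a t) + (k₁ - k₂)‖ := by congr 1; abel
    _ ≤ ‖f (y₁ + a) t - f (y₂ + a) t - Du f a t (y₁ - y₂)‖ + ‖f (y₁ + b) t - f (y₁ + a) t‖
          + ‖f b t - f a t‖ + ‖k₁ - k₂‖ :=
        (norm_add_le _ _).trans (add_le_add_left ((norm_sub_le _ _).trans
          (add_le_add_left (norm_add_le _ _) _)) _)
    _ ≤ _ := by linarith

/-! ### Response of bounded solutions to integer translations -/

/-- If `ω` is an integer and an `ε`-almost period of both `x` and `ν`, then the bounded solution `φ`
of the shifted system changes under translation by `ω` by at most a fixed multiple of `ε`. -/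
lemma norm_shift_sub_le {m n : ℕ} {f : Euc n → ℝ → Euc n} {h : Euc m → Euc n}
    (hf2 : ∀ t : ℝ, ContDiff ℝ 2 (fun u => f u t))
    (hper : ∀ (u : Euc n) (t : ℝ), f u (t + 1) = f u t) {L₂ L₃ : ℝ} (hL₂ : 0 ≤ L₂) (hL₃ : 0 ≤ L₃)
    (hhL : ∀ x₁ x₂ : Euc m, ‖h x₁ - h x₂‖ ≤ L₂ * ‖x₁ - x₂‖)
    (hfL : ∀ (u₁ u₂ : Euc n) (t : ℝ), ‖f u₁ t - f u₂ t‖ ≤ L₃ * ‖u₁ - u₂‖)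
    {ν : ℝ → Euc n} {K α P₂ r : ℝ} (hK : 0 < K) (hα : 0 < α) (hP₂ : 0 ≤ P₂)
    (hν : HasExpDichotomy (fun t => Du f (ν t) t) K α)
    (hD : ∀ (t : ℝ) (u : Euc n), ‖u - ν t‖ ≤ r → ‖Duu f u t‖ ≤ P₂)
    (hr : 2 * K / α * (P₂ * r) ≤ 1 / 2)
    {x : ℝ → Euc m} {φ : ℝ → Euc n} (hφ : IsSolution (shiftedField f h ν x) φ)
    (hφb : ∀ t, ‖φ t‖ ≤ r) {ω : ℤ} {ε : ℝ} (hxω : ∀ t, ‖x (t + ω) - x t‖ ≤ ε)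
    (hνω : ∀ t, ‖ν (t + ω) - ν t‖ ≤ ε) (t : ℝ) :
    ‖φ (t + ω) - φ t‖ ≤ 4 * K / α * (2 * L₃ * ε + L₂ * ε) := by
  have hr0 : 0 ≤ r := (norm_nonneg _).trans (hφb 0)
  have hfω : ∀ u t, f u (t + ω) = f u t := fun u t => by
    simpa using (show Function.Periodic (f u) 1 from hper u).int_mul ω t
  have hφ' : ∀ t, HasDerivAt φ (f (φ t + ν t) t - f (ν t) t + h (x t)) t := fun t =>
    (hφ t).congr_deriv (by simp only [shiftedField]; abel)
  refine hν.norm_le_of_perturbation hK hα (d := fun t => φ (t + ω) - φ t) (B := r + r)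
    (mul_nonneg hP₂ hr0) hr
    (fun t => ((hφ' (t + ω)).comp_add_const t ω).sub (hφ' t))
    (fun t => (norm_sub_le _ _).trans (add_le_add (hφb _) (hφb _))) (fun t => ?_) t
  simp only [hfω]
  exact norm_tube_diff_le (hf2 t) hL₃ (fun u₁ u₂ => hfL u₁ u₂ t) hP₂ (hD t) (hνω t) (hφb _)
    (hφb t) ((hhL _ _).trans (mul_le_mul_of_nonneg_left (hxω t) hL₂))

/-! ### Common integer almost periods -/

lemma uniformContinuous_of_hasDerivAt_bounded {n : ℕ} {g g' : ℝ → Euc n} {C : ℝ}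
    (hg : ∀ t, HasDerivAt g (g' t) t) (hC : ∀ t, ‖g' t‖ ≤ C) : UniformContinuous g := by
  refine (lipschitzWith_of_nnnorm_deriv_le (C := C.toNNReal)
    (fun t => (hg t).differentiableAt) fun t => ?_).uniformContinuous
  rw [(hg t).deriv, ← NNReal.coe_le_coe, coe_nnnorm]
  exact (hC t).trans (Real.le_coe_toNNReal C)

/-- The integer translates of a uniformly continuous almost periodic function fall into finitely
many classes of translates that are uniformly `ε`-close to each other: almost periodicity moves every
translation into a fixed compact interval, which uniform continuity cuts into finitely many pieces. -/
lemma IsAlmostPeriodic.exists_coloring {n : ℕ} {g : ℝ → Euc n} (hg : IsAlmostPeriodic g)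
    (hu : UniformContinuous g) {ε : ℝ} (hε : 0 < ε) :
    ∃ (N : ℕ) (c : ℤ → Fin N), ∀ s s' : ℤ, c s = c s' → ∀ t : ℝ, ‖g (t + s) - g (t + s')‖ < ε := by
  obtain ⟨δ, hδ, hgδ⟩ := Metric.uniformContinuous_iff.1 hu (ε / 3) (by positivity)
  obtain ⟨l, hl, hω⟩ := hg.2 (ε / 3) (by positivity)
  choose ω hωmem hωg using fun s : ℤ => hω (-(s : ℝ))
  have h0 : ∀ s : ℤ, 0 ≤ ((s : ℝ) + ω s) / δ := fun s =>
    div_nonneg (by linarith [(hωmem s).1]) hδ.le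
  refine ⟨⌊l / δ⌋₊ + 1, fun s => ⟨⌊((s : ℝ) + ω s) / δ⌋₊, Nat.lt_succ_of_le (Nat.floor_mono ?_)⟩, ?_⟩
  · gcongr
    linarith [(hωmem s).2]
  · intro s s' hss t
    have hfl : ⌊((s : ℝ) + ω s) / δ⌋₊ = ⌊((s' : ℝ) + ω s') / δ⌋₊ := congrArg Fin.val hss
    have hclose : |((s : ℝ) + ω s) / δ - ((s' : ℝ) + ω s') / δ| < 1 := by
      have a1 := Nat.floor_le (h0 s)
      have a2 := Nat.lt_floor_add_one (((s : ℝ) + ω s) / δ)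
      have a3 := Nat.floor_le (h0 s')
      have a4 := Nat.lt_floor_add_one (((s' : ℝ) + ω s') / δ)
      rw [hfl] at a1 a2
      rw [abs_lt]
      constructor <;> linarith
    rw [← sub_div, abs_div, abs_of_pos hδ, div_lt_one hδ] at hclose
    have b1 := hωg s (t + s)
    have b2 := hωg s' (t + s')
    have b3 : ‖g (t + s + ω s) - g (t + s' + ω s')‖ < ε / 3 := by
      rw [← dist_eq_norm]
      refine hgδ ?_
      rwa [Real.dist_eq, show t + s + ω s - (t + s' + ω s') = s + ω s - (s' + ω s') by ring]
    calc ‖g (t + s) - g (t + s')‖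
        = ‖(g (t + s + ω s) - g (t + s' + ω s')) - (g (t + s + ω s) - g (t + s))
            + (g (t + s' + ω s') - g (t + s'))‖ := by congr 1; abel
      _ ≤ ‖g (t + s + ω s) - g (t + s' + ω s')‖ + ‖g (t + s + ω s) - g (t + s)‖
            + ‖g (t + s' + ω s') - g (t + s')‖ :=
          (norm_add_le _ _).trans (add_le_add_left (norm_sub_le _ _) _)
      _ < ε := by linarith

/-- Two uniformly continuous almost periodic functions have a common integer `ε`-almost period in
every interval of some fixed length. -/
lemma IsAlmostPeriodic.exists_common_integer {m n : ℕ} {g : ℝ → Euc m} {k : ℝ → Euc n}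
    (hg : IsAlmostPeriodic g) (hgu : UniformContinuous g) (hk : IsAlmostPeriodic k)
    (hku : UniformContinuous k) {ε : ℝ} (hε : 0 < ε) :
    ∃ l : ℝ, 0 < l ∧ ∀ a : ℝ, ∃ ω : ℤ, (ω : ℝ) ∈ Set.Icc a (a + l) ∧
      (∀ t : ℝ, ‖g (t + ω) - g t‖ < ε) ∧ ∀ t : ℝ, ‖k (t + ω) - k t‖ < ε := by
  obtain ⟨N, c, hc⟩ := hg.exists_coloring hgu hε
  obtain ⟨N', c', hc'⟩ := hk.exists_coloring hku hε
  -- A representative of each pair of classes; by finiteness the representatives are bounded.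
  let C : ℤ → Fin N × Fin N' := fun s => (c s, c' s)
  have hrep : ∀ y : Set.range C, ∃ s, C s = y := fun y => y.2
  choose rep hrep using hrep
  obtain ⟨R, hR⟩ := (Set.finite_range fun y => |rep y|).bddAbove
  have hRep : ∀ y, |rep y| ≤ R := fun y => hR ⟨y, rfl⟩
  have hR0 : 0 ≤ R := (abs_nonneg _).trans (hRep ⟨C 0, 0, rfl⟩)
  refine ⟨2 * R + 1, by positivity, fun a => ?_⟩
  let s : ℤ := ⌈a⌉ + R
  let s' : ℤ := rep ⟨C s, s, rfl⟩
  have hs' : |s'| ≤ R := hRep _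
  have hC : C s' = C s := hrep ⟨C s, s, rfl⟩
  have hcast : ∀ t : ℝ, t - (s' : ℝ) + (s : ℝ) = t + ((s - s' : ℤ) : ℝ) := fun t => by
    push_cast
    ring
  refine ⟨s - s', ⟨?_, ?_⟩, fun t => ?_, fun t => ?_⟩
  · have h1 : ⌈a⌉ ≤ s - s' := by have := (abs_le.1 hs').2; simp only [s]; omega
    exact (Int.le_ceil a).trans (by exact_mod_cast h1)
  · have h1 : s - s' ≤ ⌈a⌉ + 2 * R := by have := (abs_le.1 hs').1; simp only [s]; omega
    have h2 : ((s - s' : ℤ) : ℝ) ≤ ⌈a⌉ + 2 * R := by exact_mod_cast h1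
    linarith [Int.ceil_lt_add_one a]
  · have := hc s s' (congrArg Prod.fst hC).symm (t - s')
    rwa [hcast, sub_add_cancel] at this
  · have := hc' s s' (congrArg Prod.snd hC).symm (t - s')
    rwa [hcast, sub_add_cancel] at this

/-! ### Almost periodicity and periodicity of the response -/

theorem mainTheorem5 {m n k : ℕ}
    (F : Euc m → ℝ → Euc m) (f : Euc n → ℝ → Euc n) (h : Euc m → Euc n)
    (hF : Continuous (Function.uncurry F))
    (hf : Continuous (Function.uncurry f))
    (hf2 : ∀ t : ℝ, ContDiff ℝ 2 (fun u => f u t))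
    (hh : Continuous h)
    -- (C1) `f` is `1`-periodic in `t`
    (C1 : ∀ (u : Euc n) (t : ℝ), f u (t + 1) = f u t)
    -- (C2) hyperbolic periodic solution with a transversal homoclinic solution
    (p q : ℝ → Euc n)
    (C2 : IsHyperbolicPeriodicSolution f p ∧ IsHomoclinicSolution f p q ∧
      VariationalOnlyZeroBounded f q)
    -- (C3) `F` is bounded
    (H₀ : ℝ) (hH₀ : 0 < H₀) (C3 : ∀ (x : Euc m) (t : ℝ), ‖F x t‖ ≤ H₀)
    -- (C4) two-sided Lipschitz condition on `h`, Lipschitz condition on `f`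
    (L₁ L₂ L₃ : ℝ) (hL₁ : 0 < L₁) (hL₂ : 0 < L₂) (hL₃ : 0 < L₃)
    (C4h : ∀ x₁ x₂ : Euc m,
      L₁ * ‖x₁ - x₂‖ ≤ ‖h x₁ - h x₂‖ ∧ ‖h x₁ - h x₂‖ ≤ L₂ * ‖x₁ - x₂‖)
    (C4f : ∀ (u₁ u₂ : Euc n) (t : ℝ), ‖f u₁ t - f u₂ t‖ ≤ L₃ * ‖u₁ - u₂‖)
    -- (C5) `f` is bounded
    (M_f : ℝ) (hM_f : 0 < M_f) (C5 : ∀ (u : Euc n) (t : ℝ), ‖f u t‖ ≤ M_f)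
    -- the bounded solutions `ν_β`, with dichotomy constants uniform in `β`
    (ν : (ℤ → Fin k) → ℝ → Euc n) (K α : ℝ) (hK : 0 < K) (hα : 0 < α)
    (hν : ∀ β, IsSolution f (ν β)) (hνb : ∀ β, IsBoundedOnLine (ν β))
    (hνd : ∀ β, HasExpDichotomy (fun t => Du f (ν β t) t) K α)
    (H : ℝ) (hH : 0 < H)
    -- `P₂` bounds the second derivative of `f` on the `r₁`-tubes around the `ν_β`
    (P₂ : ℝ) (hP₂ : 0 < P₂)
    (hP₂b : ∀ β (t : ℝ) (u : Euc n), ‖u - ν β t‖ ≤ r1 K α P₂ (supOnBall h H) →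
      ‖Duu f u t‖ ≤ P₂)
    -- (C6) smallness of `M_h`
    (C6 : supOnBall h H < α ^ 2 / (16 * K ^ 2 * P₂ ^ 2))
    -- the solution `φ = φ_x^β`
    (x : ℝ → Euc m) (hx : x ∈ boundedSolutions F H) (β : ℤ → Fin k)
    (φ : ℝ → Euc n) (hφ : IsSolution (shiftedField f h (ν β) x) φ)
    (hφb : ∀ t : ℝ, ‖φ t‖ ≤ r1 K α P₂ (supOnBall h H)) :
    (IsAlmostPeriodic x → IsAlmostPeriodic (ν β) → IsAlmostPeriodic φ) ∧
    (∀ l i : ℕ, Function.Periodic x ((i : ℝ) * (l : ℝ)) →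
      Function.Periodic (ν β) ((i : ℝ) * (l : ℝ)) →
      Function.Periodic φ ((i : ℝ) * (l : ℝ))) := by
  have key := fun (ω : ℤ) (ε : ℝ) => norm_shift_sub_le (ω := ω) (ε := ε) hf2 C1 hL₂.le hL₃.le
    (fun x₁ x₂ => (C4h x₁ x₂).2) C4f hK hα hP₂.le (hνd β) (hP₂b β) (r1_mul_le hK hα hP₂ C6) hφ hφb
  refine ⟨fun hxap hνap => ⟨?_, fun ε hε => ?_⟩, fun l i hxper hνper t => ?_⟩
  · exact continuous_iff_continuousAt.2 fun t => (hφ t).continuousAt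
  · have hxu : UniformContinuous x :=
      uniformContinuous_of_hasDerivAt_bounded hx.1 fun t => C3 _ _
    have hνu : UniformContinuous (ν β) :=
      uniformContinuous_of_hasDerivAt_bounded (hν β) fun t => C5 _ _
    set c : ℝ := 4 * K / α * (2 * L₃ + L₂) with hc
    have hc0 : 0 < c := by positivity
    obtain ⟨l, hl, hω⟩ := hxap.exists_common_integer hxu hνap hνu (ε := ε / (2 * c))
      (by positivity)
    refine ⟨l, hl, fun a => ?_⟩
    obtain ⟨ω, hmem, hxω, hνω⟩ := hω a
    refine ⟨ω, hmem, fun t => ?_⟩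
    refine (key ω _ (fun t => (hxω t).le) (fun t => (hνω t).le) t).trans_lt ?_
    calc 4 * K / α * (2 * L₃ * (ε / (2 * c)) + L₂ * (ε / (2 * c)))
        = c * (ε / (2 * c)) := by rw [hc]; ring
      _ = ε / 2 := by field_simp
      _ < ε := half_lt_self hε
  · have hT : ((((i : ℤ) * (l : ℤ) : ℤ)) : ℝ) = (i : ℝ) * (l : ℝ) := by push_cast; rfl
    have h1 := key ((i : ℤ) * (l : ℤ)) 0 (fun t => by rw [hT, hxper t]; simp)
      (fun t => by rw [hT, hνper t]; simp) t
    rw [hT] at h1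
    simpa [sub_eq_zero] using h1
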